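/- Let $b\in\mathbb C\setminus\{0,i,-i\}$ and write $[x,y]=xy-yx$, $\{x,y\}=xy+yx$. Let $S=S(0,b^2,-b^2)$ be the $\mathbb C$-algebra with generators $x_0,x_1,x_2,x_3$ and relations $$[x_0,x_1]=0,\quad [x_0,x_2]=b^2\{x_1,x_3\},\quad [x_0,x_3]=-b^2\{x_1,x_2\},$$ $$\{x_0,x_1\}=[x_2,x_3],\quad \{x_0,x_2\}=[x_3,x_1],\quad \{x_0,x_3\}=[x_1,x_2],$$ graded by $\deg x_j=1$. Put $$q=\frac{1-ib}{1+ib},\quad E=\tfrac i2(1-ib)(x_2+ix_3),\quad F=\tfrac i2(1+ib)(x_2-ix_3),\quad K=x_0+bx_1,\quad K'=x_0-bx_1,$$ and let $\sqrt q$ be a fixed square root of $q$. (1) The algebra $S$ is the $\mathbb C$-algebra generated by $E,F,K,K'$ modulo the relations $$KE=qEK,\quad KF=q^{-1}FK,\quad KK'=K'K,\quad K'E=q^{-1}EK',\quad K'F=qFK',\quad [E,F]=\frac{K^2-K'^2}{q-q^{-1}};$$ that is, there is an isomorphism from the $\mathbb C$-algebra on four free generators modulo these relations onto $S$ that sends the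 generators to $E,F,K,K'$. (2) Let $U_q(\mathfrak{sl}_2)$ be the $\mathbb C$-algebra with generators $e,f,k,k^{-1}$ and relations $$ke=q^2ek,\quad kf=q^{-2}fk,\quad kk^{-1}=k^{-1}k=1,\quad [e,f]=\frac{k-k^{-1}}{q-q^{-1}}.$$ Let $S[(KK')^{-1}]$ be the localization of $S$ at the powers of the central element $KK'$, and let $S[(KK')^{-1}]_0$ be its degree-zero part, i.e. the subalgebra of all $s(KK')^{-n}$ with $n\ge 0$ and $s\in S$ homogeneous of degree $2n$. Then $EK^{-1}$, $F(K')^{-1}$ and $K(K')^{-1}$ lie in $S[(KK')^{-1}]_0$, and there is a $\mathbb C$-algebra isomorphism $S[(KK')^{-1}]_0\to U_q(\mathfrak{sl}_2)$ with $$EK^{-1}\mapsto\sqrt q\,e,\qquad F(K')^{-1}\mapsto\sqrt q\,f,\qquad K(K')^{-1}\mapsto k .$$ -/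

import Mathlib

namespace DegenerateSklyanin

noncomputable section

open OreLocalization

/-! ### The algebra with four generators and the Sklyanin relations -/

/-- The defining relations of `S(α, β, γ)` on the free algebra on `x₀, x₁, x₂, x₃`, with
`[x, y] = x y - y x` and `{x, y} = x y + y x`. -/
inductive SklyaninRel (α β γ : ℂ) : FreeAlgebra ℂ (Fin 4) → FreeAlgebra ℂ (Fin 4) → Prop
  | comm01 : SklyaninRel α β γ
      (.ι ℂ 0 * .ι ℂ 1 - .ι ℂ 1 * .ι ℂ 0) (α • (.ι ℂ 2 * .ι ℂ 3 + .ι ℂ 3 * .ι ℂ 2))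
  | comm02 : SklyaninRel α β γ
      (.ι ℂ 0 * .ι ℂ 2 - .ι ℂ 2 * .ι ℂ 0) (β • (.ι ℂ 1 * .ι ℂ 3 + .ι ℂ 3 * .ι ℂ 1))
  | comm03 : SklyaninRel α β γ
      (.ι ℂ 0 * .ι ℂ 3 - .ι ℂ 3 * .ι ℂ 0) (γ • (.ι ℂ 1 * .ι ℂ 2 + .ι ℂ 2 * .ι ℂ 1))
  | anti01 : SklyaninRel α β γ
      (.ι ℂ 0 * .ι ℂ 1 + .ι ℂ 1 * .ι ℂ 0) (.ι ℂ 2 * .ι ℂ 3 - .ι ℂ 3 * .ι ℂ 2)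
  | anti02 : SklyaninRel α β γ
      (.ι ℂ 0 * .ι ℂ 2 + .ι ℂ 2 * .ι ℂ 0) (.ι ℂ 3 * .ι ℂ 1 - .ι ℂ 1 * .ι ℂ 3)
  | anti03 : SklyaninRel α β γ
      (.ι ℂ 0 * .ι ℂ 3 + .ι ℂ 3 * .ι ℂ 0) (.ι ℂ 1 * .ι ℂ 2 - .ι ℂ 2 * .ι ℂ 1)

/-- The `ℂ`-algebra `S(α, β, γ)`. -/
abbrev Sklyanin (α β γ : ℂ) : Type := RingQuot (SklyaninRel α β γ)

/-- The degenerate algebra `S = S(0, b², -b²)`. -/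
abbrev S (b : ℂ) : Type := Sklyanin 0 (b ^ 2) (-b ^ 2)

/-- The generators `x₀, x₁, x₂, x₃` of `S`. -/
def x (b : ℂ) (i : Fin 4) : S b :=
  RingQuot.mkAlgHom ℂ (SklyaninRel 0 (b ^ 2) (-b ^ 2)) (FreeAlgebra.ι ℂ i)

/-- The degree `n` component `S_n` for the grading with `deg x_i = 1`: the linear span of all
products of `n` generators. -/
def component (b : ℂ) (n : ℕ) : Submodule ℂ (S b) :=
  Submodule.span ℂ (Set.range (x b)) ^ n

/-- `q = (1 - i b) / (1 + i b)`. -/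
def q (b : ℂ) : ℂ := (1 - Complex.I * b) / (1 + Complex.I * b)

/-- `E = (i/2) (1 - i b) (x₂ + i x₃)`. -/
def E (b : ℂ) : S b :=
  (Complex.I / 2 * (1 - Complex.I * b)) • (x b 2 + Complex.I • x b 3)

/-- `F = (i/2) (1 + i b) (x₂ - i x₃)`. -/
def F (b : ℂ) : S b :=
  (Complex.I / 2 * (1 + Complex.I * b)) • (x b 2 - Complex.I • x b 3)

/-- `K = x₀ + b x₁`. -/
def K (b : ℂ) : S b := x b 0 + b • x b 1

/-- `K' = x₀ - b x₁`. -/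
def K' (b : ℂ) : S b := x b 0 - b • x b 1

/-! ### The algebra presented by the generators `E, F, K, K'` -/

/-- Names of the four generators `E, F, K, K'`. -/
inductive Gen
  | E | F | K | K'

/-- The relations `KE = qEK`, `KF = q⁻¹FK`, `KK' = K'K`, `K'E = q⁻¹EK'`, `K'F = qFK'`,
`[E, F] = (K² - K'²) / (q - q⁻¹)`. -/
inductive EFKRel (q : ℂ) : FreeAlgebra ℂ Gen → FreeAlgebra ℂ Gen → Prop
  | KE : EFKRel q (.ι ℂ .K * .ι ℂ .E) (q • (.ι ℂ .E * .ι ℂ .K))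
  | KF : EFKRel q (.ι ℂ .K * .ι ℂ .F) (q⁻¹ • (.ι ℂ .F * .ι ℂ .K))
  | KK' : EFKRel q (.ι ℂ .K * .ι ℂ .K') (.ι ℂ .K' * .ι ℂ .K)
  | K'E : EFKRel q (.ι ℂ .K' * .ι ℂ .E) (q⁻¹ • (.ι ℂ .E * .ι ℂ .K'))
  | K'F : EFKRel q (.ι ℂ .K' * .ι ℂ .F) (q • (.ι ℂ .F * .ι ℂ .K'))
  | EF : EFKRel q (.ι ℂ .E * .ι ℂ .F - .ι ℂ .F * .ι ℂ .E)
      ((q - q⁻¹)⁻¹ • (.ι ℂ .K ^ 2 - .ι ℂ .K' ^ 2))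

/-- The `ℂ`-algebra generated by `E, F, K, K'` modulo the relations `EFKRel q`. -/
abbrev EFKAlgebra (q : ℂ) : Type := RingQuot (EFKRel q)

/-- The generators of `EFKAlgebra q`. -/
def EFKAlgebra.gen (q : ℂ) (g : Gen) : EFKAlgebra q :=
  RingQuot.mkAlgHom ℂ (EFKRel q) (FreeAlgebra.ι ℂ g)

/-! ### The quantized enveloping algebra of `sl₂` -/

/-- Names of the four generators `e, f, k, k⁻¹`. -/
inductive UGen
  | e | f | k | kinv

/-- The relations `ke = q²ek`, `kf = q⁻²fk`, `k k⁻¹ = k⁻¹ k = 1`,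
`[e, f] = (k - k⁻¹) / (q - q⁻¹)`. -/
inductive UqRel (q : ℂ) : FreeAlgebra ℂ UGen → FreeAlgebra ℂ UGen → Prop
  | ke : UqRel q (.ι ℂ .k * .ι ℂ .e) (q ^ 2 • (.ι ℂ .e * .ι ℂ .k))
  | kf : UqRel q (.ι ℂ .k * .ι ℂ .f) ((q ^ 2)⁻¹ • (.ι ℂ .f * .ι ℂ .k))
  | k_kinv : UqRel q (.ι ℂ .k * .ι ℂ .kinv) 1
  | kinv_k : UqRel q (.ι ℂ .kinv * .ι ℂ .k) 1
  | ef : UqRel q (.ι ℂ .e * .ι ℂ .f - .ι ℂ .f * .ι ℂ .e)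
      ((q - q⁻¹)⁻¹ • (.ι ℂ .k - .ι ℂ .kinv))

/-- The quantized enveloping algebra `U_q(sl₂)`. -/
abbrev Uq (q : ℂ) : Type := RingQuot (UqRel q)

/-- The generators of `U_q(sl₂)`. -/
def Uq.gen (q : ℂ) (g : UGen) : Uq q :=
  RingQuot.mkAlgHom ℂ (UqRel q) (FreeAlgebra.ι ℂ g)

/-! ### The localization `S[(KK')⁻¹]` and its degree zero part -/

theorem x_comm01 (b : ℂ) : x b 0 * x b 1 = x b 1 * x b 0 := by
  have h := RingQuot.mkAlgHom_rel ℂ (SklyaninRel.comm01 (α := 0) (β := b ^ 2) (γ := -b ^ 2))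
  simp only [map_mul, map_sub, zero_smul, map_zero] at h
  exact sub_eq_zero.mp h

theorem K_mul_K' (b : ℂ) : K b * K' b = x b 0 * x b 0 - b ^ 2 • (x b 1 * x b 1) := by
  simp only [K, K', add_mul, mul_sub, smul_mul_assoc, mul_smul_comm, x_comm01]
  module

theorem K_comm_K' (b : ℂ) : K b * K' b = K' b * K b := by
  simp only [K, K', add_mul, mul_sub, sub_mul, mul_add, smul_mul_assoc, mul_smul_comm, x_comm01]
  module

theorem central_aux {A : Type} [Ring A] [Algebra ℂ A] (c : ℂ) (y : Fin 4 → A)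
    (h01 : y 0 * y 1 = y 1 * y 0)
    (h02 : y 0 * y 2 - y 2 * y 0 = c • (y 1 * y 3 + y 3 * y 1))
    (h03 : y 0 * y 3 - y 3 * y 0 = (-c) • (y 1 * y 2 + y 2 * y 1))
    (a02 : y 0 * y 2 + y 2 * y 0 = y 3 * y 1 - y 1 * y 3)
    (a03 : y 0 * y 3 + y 3 * y 0 = y 1 * y 2 - y 2 * y 1) (i : Fin 4) :
    Commute (y 0 * y 0 - c • (y 1 * y 1)) (y i) := by
  have c01 : Commute (y 0) (y 1) := h01
  have l (a : A) {u v : A} (h : u = v) : a * u = a * v := by rw [h]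
  have r (a : A) {u v : A} (h : u = v) : u * a = v * a := by rw [h]
  fin_cases i
  · exact ((Commute.refl _).mul_left (Commute.refl _)).sub_left
      ((c01.symm.mul_left c01.symm).smul_left c)
  · exact (c01.mul_left c01).sub_left
      (((Commute.refl _).mul_left (Commute.refl _)).smul_left c)
  · change (y 0 * y 0 - c • (y 1 * y 1)) * y 2 = y 2 * (y 0 * y 0 - c • (y 1 * y 1))
    have e1 := l (y 0) h02
    have e2 := r (y 0) h02
    have e3 := l (y 1) a03
    have e4 := r (y 1) a03
    have e5 := l (y 3) h01
    have e6 := r (y 3) h01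
    simp only [mul_add, mul_sub, add_mul, sub_mul, smul_mul_assoc, mul_smul_comm,
      mul_assoc] at e1 e2 e3 e4 e5 e6 ⊢
    linear_combination (norm := module) e1 + e2 + c • (e3 + e4) + c • (e6 - e5)
  · change (y 0 * y 0 - c • (y 1 * y 1)) * y 3 = y 3 * (y 0 * y 0 - c • (y 1 * y 1))
    have e1 := l (y 0) h03
    have e2 := r (y 0) h03
    have e3 := l (y 1) a02
    have e4 := r (y 1) a02
    have e5 := l (y 2) h01
    have e6 := r (y 2) h01
    simp only [mul_add, mul_sub, add_mul, sub_mul, smul_mul_assoc, mul_smul_comm,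
      mul_assoc] at e1 e2 e3 e4 e5 e6 ⊢
    linear_combination (norm := module) e1 + e2 - c • (e3 + e4) - c • (e6 - e5)

/-- `KK'` is central in `S`. -/
theorem KK'_central (b : ℂ) (s : S b) : Commute (K b * K' b) s := by
  have h01 := x_comm01 b
  have h02 := RingQuot.mkAlgHom_rel ℂ (SklyaninRel.comm02 (α := 0) (β := b ^ 2) (γ := -b ^ 2))
  have h03 := RingQuot.mkAlgHom_rel ℂ (SklyaninRel.comm03 (α := 0) (β := b ^ 2) (γ := -b ^ 2))
  have a02 := RingQuot.mkAlgHom_rel ℂ (SklyaninRel.anti02 (α := 0) (β := b ^ 2) (γ := -b ^ 2))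
  have a03 := RingQuot.mkAlgHom_rel ℂ (SklyaninRel.anti03 (α := 0) (β := b ^ 2) (γ := -b ^ 2))
  simp only [map_mul, map_sub, map_add, map_smul] at h02 h03 a02 a03
  have key : ∀ i : Fin 4, Commute (K b * K' b) (x b i) := by
    intro i
    rw [K_mul_K']
    change x b 0 * x b 2 - x b 2 * x b 0 = b ^ 2 • (x b 1 * x b 3 + x b 3 * x b 1) at h02
    change x b 0 * x b 3 - x b 3 * x b 0 = (-b ^ 2) • (x b 1 * x b 2 + x b 2 * x b 1) at h03
    change x b 0 * x b 2 + x b 2 * x b 0 = x b 3 * x b 1 - x b 1 * x b 3 at a02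
    change x b 0 * x b 3 + x b 3 * x b 0 = x b 1 * x b 2 - x b 2 * x b 1 at a03
    exact central_aux (b ^ 2) (x b) h01 h02 h03 a02 a03 i
  obtain ⟨w, rfl⟩ := RingQuot.mkAlgHom_surjective ℂ (SklyaninRel 0 (b ^ 2) (-b ^ 2)) s
  induction w using FreeAlgebra.induction with
  | grade0 r => rw [AlgHom.commutes]; exact (Algebra.commutes _ _).symm
  | grade1 i => exact key i
  | mul u v hu hv => rw [map_mul]; exact hu.mul_right hv
  | add u v hu hv => rw [map_add]; exact hu.add_right hv

/-- The multiplicative set of all powers of `KK'`. -/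
abbrev powersKK' (b : ℂ) : Submonoid (S b) := Submonoid.powers (K b * K' b)

theorem powersKK'_central (b : ℂ) (t : powersKK' b) (s : S b) : (t : S b) * s = s * t := by
  obtain ⟨_, n, rfl⟩ := t
  exact ((KK'_central b s).pow_left n).eq

instance (b : ℂ) : OreSet (powersKK' b) where
  ore_right_cancel r₁ r₂ s h := ⟨s, by rw [powersKK'_central, powersKK'_central, h]⟩
  oreNum r _ := r
  oreDenom _ s := s
  ore_eq r s := powersKK'_central b s r

/-- The localization `S[(KK')⁻¹]`. -/
abbrev SLoc (b : ℂ) : Type := OreLocalization (powersKK' b) (S b)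

/-- The canonical map `S → S[(KK')⁻¹]`. -/
abbrev toLoc (b : ℂ) : S b →+* SLoc b := numeratorRingHom

/-- `(KK')ⁿ` as an element of the multiplicative set. -/
def powKK' (b : ℂ) (n : ℕ) : powersKK' b := ⟨(K b * K' b) ^ n, n, rfl⟩

theorem x_mem (b : ℂ) (i : Fin 4) : x b i ∈ Submodule.span ℂ (Set.range (x b)) :=
  Submodule.subset_span ⟨i, rfl⟩

theorem powKK'_mem (b : ℂ) (n : ℕ) : (powKK' b n : S b) ∈ component b (2 * n) := by
  have h : K b * K' b ∈ Submodule.span ℂ (Set.range (x b)) ^ 2 := by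
    rw [pow_two (Submodule.span ℂ (Set.range (x b)))]
    exact Submodule.mul_mem_mul
      (add_mem (x_mem b 0) (Submodule.smul_mem _ _ (x_mem b 1)))
      (sub_mem (x_mem b 0) (Submodule.smul_mem _ _ (x_mem b 1)))
  rw [component, pow_mul]
  exact Submodule.pow_mem_pow _ h n

theorem component_mul_mem (b : ℂ) {m n : ℕ} {s t : S b} (hs : s ∈ component b m)
    (ht : t ∈ component b n) : s * t ∈ component b (m + n) := by
  rw [component, pow_add]
  exact Submodule.mul_mem_mul hs ht

theorem powKK'_mul (b : ℂ) (m n : ℕ) : powKK' b m * powKK' b n = powKK' b (m + n) :=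
  Subtype.ext (pow_add _ _ _).symm

/-- The degree zero part `S[(KK')⁻¹]₀`: all fractions `s (KK')⁻ⁿ` with `s` homogeneous of degree
`2n`. -/
def SLocZero (b : ℂ) : Subalgebra ℂ (SLoc b) where
  carrier := {z | ∃ n : ℕ, ∃ s ∈ component b (2 * n), z = s /ₒ powKK' b n}
  mul_mem' := by
    rintro _ _ ⟨m, s, hs, rfl⟩ ⟨n, t, ht, rfl⟩
    refine ⟨n + m, s * t, ?_, ?_⟩
    · have := component_mul_mem b hs ht
      rwa [← mul_add, add_comm m n] at this
    · rw [oreDiv_mul_char s t _ _ s (powKK' b n) (powersKK'_central b _ _), powKK'_mul]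
  add_mem' := by
    rintro _ _ ⟨m, s, hs, rfl⟩ ⟨n, t, ht, rfl⟩
    refine ⟨n + m, powKK' b n * s + powKK' b m * t, ?_, ?_⟩
    · refine add_mem ?_ ?_
      · rw [mul_add]
        exact component_mul_mem b (powKK'_mem b n) hs
      · rw [mul_add, add_comm]
        exact component_mul_mem b (powKK'_mem b m) ht
    · rw [oreDiv_add_char _ _ (powKK' b m : S b) (powKK' b n) (powersKK'_central b _ _),
        powKK'_mul]
      rfl
  algebraMap_mem' c := by
    refine ⟨0, algebraMap ℂ (S b) c, ?_, ?_⟩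
    · rw [mul_zero, component, pow_zero]
      exact Submodule.algebraMap_mem c
    · have : powKK' b 0 = 1 := Subtype.ext (pow_zero _)
      rw [this]
      rfl

/-- The element `(KK')⁻¹` of `S[(KK')⁻¹]`. -/
def invKK' (b : ℂ) : SLoc b := 1 /ₒ powKK' b 1

theorem mul_invKK' (b : ℂ) : toLoc b (K b * K' b) * invKK' b = 1 := by
  have h : K b * K' b = (powKK' b 1 : S b) := (pow_one _).symm
  rw [h]
  exact OreLocalization.mul_inv (powKK' b 1) 1

theorem invKK'_comm (b : ℂ) (s : S b) : invKK' b * toLoc b s = toLoc b s * invKK' b := by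
  change (1 : S b) /ₒ powKK' b 1 * (s /ₒ 1) = s /ₒ 1 * (1 /ₒ powKK' b 1)
  rw [mul_div_one, oreDiv_mul_char s 1 1 _ s (powKK' b 1) (powersKK'_central b _ _), one_mul,
    mul_one, mul_one]

/-- `K` as a unit of `S[(KK')⁻¹]`. -/
def unitK (b : ℂ) : (SLoc b)ˣ where
  val := toLoc b (K b)
  inv := toLoc b (K' b) * invKK' b
  val_inv := by rw [← mul_assoc, ← map_mul, mul_invKK']
  inv_val := by
    rw [mul_assoc, invKK'_comm, ← mul_assoc, ← map_mul, ← K_comm_K', mul_invKK']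

/-- `K'` as a unit of `S[(KK')⁻¹]`. -/
def unitK' (b : ℂ) : (SLoc b)ˣ where
  val := toLoc b (K' b)
  inv := toLoc b (K b) * invKK' b
  val_inv := by rw [← mul_assoc, ← map_mul, ← K_comm_K', mul_invKK']
  inv_val := by
    rw [mul_assoc, invKK'_comm, ← mul_assoc, ← map_mul, mul_invKK']

end

end DegenerateSklyanin

namespace DegenerateSklyanin

open Complex OreLocalization

/-! For (1), the map `(x₂, x₃) ↦ (x₃, -x₂)` in the mixed relations of `S` has eigenvectors `x₂ ± i
x₃`. On such an eigenvector a commutator and an anticommutator relation remain, and together they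
say exactly that `K` and `K'` skew-commute with it (`skew_of_comm_anti`, `comm_anti_of_skew`). The
relation `{x₀, x₁} = [x₂, x₃]` becomes the formula for `[E, F]`. Since `b ≠ 0, ±i`, the change of
generators is invertible, and the two homomorphisms given by the presentations are mutually inverse.

For (2), the elements `r⁻¹EK⁻¹`, `r⁻¹FK'⁻¹`, `KK'⁻¹` with `r = √q` satisfy the relations of
`U_q(sl₂)` (`IsEFK.isUq`), which gives a map `uqToSLoc` from `U_q(sl₂)` to the localization.

It is injective without any basis theorem. With `σ` the automorphism `e ↦ qe`, `f ↦ q⁻¹f`, `k ↦ k`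
and `L` left multiplication, the operators `L(re)σ`, `L(rfk⁻¹)σ`, `σ`, `L(k⁻¹)σ` on `U_q(sl₂)`
satisfy the relations of `E, F, K, K'` (`isEFK_end`). The action extends to the localization, and
its composite with `uqToSLoc` is the left regular representation, which is faithful.

The image is the whole degree-zero part: each generator of `S` is an element of the image times `K`,
and conjugation by `K` acts on the image as `σ`, so degree `n` lies in the image times `Kⁿ`
(`exists_uqToSLoc_mul_pow`). Finally `K²ⁿ = (KK'⁻¹)ⁿ(KK')ⁿ`. -/

theorem one_add_I_mul_ne_zero {b : ℂ} (hb1 : b ≠ I) : 1 + I * b ≠ 0 := by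
  intro h
  apply hb1
  linear_combination (-I) * h + b * I_sq

theorem one_sub_I_mul_ne_zero {b : ℂ} (hb2 : b ≠ -I) : 1 - I * b ≠ 0 := by
  intro h
  apply hb2
  linear_combination I * h + b * I_sq

theorem q_ne_zero {b : ℂ} (hb1 : b ≠ I) (hb2 : b ≠ -I) : q b ≠ 0 :=
  div_ne_zero (one_sub_I_mul_ne_zero hb2) (one_add_I_mul_ne_zero hb1)

theorem q_sub_inv {b : ℂ} (hb1 : b ≠ I) (hb2 : b ≠ -I) :
    q b - (q b)⁻¹ = -4 * I * b / (1 + b ^ 2) := by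
  have h1 := one_add_I_mul_ne_zero hb1
  have h2 := one_sub_I_mul_ne_zero hb2
  have h3 : 1 + b ^ 2 = (1 + I * b) * (1 - I * b) := by linear_combination b ^ 2 * I_sq
  rw [q, h3]
  field_simp
  ring

/-- The defining relations of `S` other than `x_comm01`. -/
theorem x_relations (b : ℂ) :
    x b 0 * x b 2 - x b 2 * x b 0 = b ^ 2 • (x b 1 * x b 3 + x b 3 * x b 1) ∧
    x b 0 * x b 3 - x b 3 * x b 0 = (-b ^ 2) • (x b 1 * x b 2 + x b 2 * x b 1) ∧
    x b 0 * x b 1 + x b 1 * x b 0 = x b 2 * x b 3 - x b 3 * x b 2 ∧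
    x b 0 * x b 2 + x b 2 * x b 0 = x b 3 * x b 1 - x b 1 * x b 3 ∧
    x b 0 * x b 3 + x b 3 * x b 0 = x b 1 * x b 2 - x b 2 * x b 1 := by
  have h02 := RingQuot.mkAlgHom_rel ℂ (SklyaninRel.comm02 (α := 0) (β := b ^ 2) (γ := -b ^ 2))
  have h03 := RingQuot.mkAlgHom_rel ℂ (SklyaninRel.comm03 (α := 0) (β := b ^ 2) (γ := -b ^ 2))
  have a01 := RingQuot.mkAlgHom_rel ℂ (SklyaninRel.anti01 (α := 0) (β := b ^ 2) (γ := -b ^ 2))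
  have a02 := RingQuot.mkAlgHom_rel ℂ (SklyaninRel.anti02 (α := 0) (β := b ^ 2) (γ := -b ^ 2))
  have a03 := RingQuot.mkAlgHom_rel ℂ (SklyaninRel.anti03 (α := 0) (β := b ^ 2) (γ := -b ^ 2))
  simp only [map_mul, map_sub, map_add, map_smul] at h02 h03 a01 a02 a03
  exact ⟨h02, h03, a01, a02, a03⟩

/-! ### Sklyanin relations versus skew-commutation with `K` and `K'` -/

variable {A : Type*} [Ring A] [Algebra ℂ A]

/-- Elements `E, F, K, K'` of an algebra that satisfy the relations `EFKRel q`. -/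
structure IsEFK (q : ℂ) (e f k k' : A) : Prop where
  KE : k * e = q • (e * k)
  KF : k * f = q⁻¹ • (f * k)
  KK' : k * k' = k' * k
  K'E : k' * e = q⁻¹ • (e * k')
  K'F : k' * f = q • (f * k')
  EF : e * f - f * e = (q - q⁻¹)⁻¹ • (k ^ 2 - k' ^ 2)

theorem IsEFK.map {B : Type*} [Ring B] [Algebra ℂ B] {q : ℂ} {e f k k' : A}
    (h : IsEFK q e f k k') (φ : A →ₐ[ℂ] B) : IsEFK q (φ e) (φ f) (φ k) (φ k') where
  KE := by rw [← map_mul, h.KE, map_smul, map_mul]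
  KF := by rw [← map_mul, h.KF, map_smul, map_mul]
  KK' := by rw [← map_mul, h.KK', map_mul]
  K'E := by rw [← map_mul, h.K'E, map_smul, map_mul]
  K'F := by rw [← map_mul, h.K'F, map_smul, map_mul]
  EF := by rw [← map_mul, ← map_mul, ← map_sub, h.EF, map_smul, map_sub, map_pow, map_pow]

/-- The sum `hc + jb · ha` is the claim once `j² = -1` is used. The signs of `j` and `b` are free:
`j = ±i` selects `E` or `F`, and `±b` selects `K` or `K'`. -/
theorem skew_of_comm_anti {j b : ℂ} (hj : j * j = -1) {u v y : A}
    (hc : u * y - y * u = -(j * b ^ 2) • (v * y + y * v))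
    (ha : u * y + y * u = j • (v * y - y * v)) :
    (1 + j * b) • ((u + b • v) * y) = (1 - j * b) • (y * (u + b • v)) := by
  -- `module` treats `j` as an indeterminate, so `j² = -1` has to enter as an identity between
  -- vectors.
  have h (w : A) : (j * j) • w = -w := by rw [hj, neg_one_smul]
  simp only [add_mul, mul_add, smul_mul_assoc, mul_smul_comm]
  linear_combination (norm := module) hc + (j * b) • ha + b • h (v * y - y * v)

/-- Converse of `skew_of_comm_anti`: half the sum of the two skew relations is the commutator
relation, half their difference is `jb` times the anticommutator relation. The latter needs `b ≠ 0`.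
-/
theorem comm_anti_of_skew {j b : ℂ} (hj : j * j = -1) (hb : b ≠ 0) {u v y : A}
    (h₁ : (1 + j * b) • ((u + b • v) * y) = (1 - j * b) • (y * (u + b • v)))
    (h₂ : (1 - j * b) • ((u - b • v) * y) = (1 + j * b) • (y * (u - b • v))) :
    u * y - y * u = -(j * b ^ 2) • (v * y + y * v) ∧
    u * y + y * u = j • (v * y - y * v) := by
  have h (w : A) : (j * j) • w = -w := by rw [hj, neg_one_smul]
  simp only [add_mul, mul_add, sub_mul, mul_sub, smul_mul_assoc, mul_smul_comm] at h₁ h₂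
  constructor
  · linear_combination (norm := module) (1 / 2 : ℂ) • h₁ + (1 / 2 : ℂ) • h₂
  · have hjb : j * b ≠ 0 := mul_ne_zero (by rintro rfl; simp at hj) hb
    have key : (j * b) • (u * y + y * u) = (j * b) • (j • (v * y - y * v)) := by
      linear_combination (norm := module) (1 / 2 : ℂ) • h₁ - (1 / 2 : ℂ) • h₂
        - b • h (v * y - y * v)
    exact (smul_right_inj hjb).mp key

theorem isEFK_S {b : ℂ} (hb0 : b ≠ 0) (hb1 : b ≠ I) (hb2 : b ≠ -I) :
    IsEFK (q b) (E b) (F b) (K b) (K' b) := by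
  obtain ⟨h02, h03, a01, a02, a03⟩ := x_relations b
  have h01 := x_comm01 b
  have h1 := one_add_I_mul_ne_zero hb1
  have h2 := one_sub_I_mul_ne_zero hb2
  have hI (w : S b) : (I * I) • w = -w := by rw [I_mul_I]; module
  have hIn : -I * -I = -1 := by rw [neg_mul_neg, I_mul_I]
  have cE : x b 0 * (x b 2 + I • x b 3) - (x b 2 + I • x b 3) * x b 0 = -(I * b ^ 2) •
      (x b 1 * (x b 2 + I • x b 3) + (x b 2 + I • x b 3) * x b 1) := by
    simp only [add_mul, mul_add, smul_mul_assoc, mul_smul_comm]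
    linear_combination (norm := module) h02 + I • h03
      + (b ^ 2) • hI (x b 1 * x b 3 + x b 3 * x b 1)
  have aE : x b 0 * (x b 2 + I • x b 3) + (x b 2 + I • x b 3) * x b 0 = I •
      (x b 1 * (x b 2 + I • x b 3) - (x b 2 + I • x b 3) * x b 1) := by
    simp only [add_mul, mul_add, smul_mul_assoc, mul_smul_comm]
    linear_combination (norm := module) a02 + I • a03 - hI (x b 1 * x b 3 - x b 3 * x b 1)
  have cF : x b 0 * (x b 2 - I • x b 3) - (x b 2 - I • x b 3) * x b 0 = -(-I * b ^ 2) •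
      (x b 1 * (x b 2 - I • x b 3) + (x b 2 - I • x b 3) * x b 1) := by
    simp only [sub_mul, mul_sub, smul_mul_assoc, mul_smul_comm]
    linear_combination (norm := module) h02 - I • h03
      + (b ^ 2) • hI (x b 1 * x b 3 + x b 3 * x b 1)
  have aF : x b 0 * (x b 2 - I • x b 3) + (x b 2 - I • x b 3) * x b 0 = -I •
      (x b 1 * (x b 2 - I • x b 3) - (x b 2 - I • x b 3) * x b 1) := by
    simp only [sub_mul, mul_sub, smul_mul_assoc, mul_smul_comm]
    linear_combination (norm := module) a02 - I • a03 - hI (x b 1 * x b 3 - x b 3 * x b 1)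
  have flip {c d : ℂ} (hc : c ≠ 0) {v w : S b} (h : c • v = d • w) : v = (d / c) • w := by
    rw [div_eq_inv_mul, mul_smul, ← h, inv_smul_smul₀ hc]
  have hq : (q b)⁻¹ = (1 + I * b) / (1 - I * b) := inv_div _ _
  -- `K'` is `K` with `-b` for `b`, and the relations of `S` involve only `b²`; this reduces the
  -- `K'` relations to the lemma used for `K`.
  have eK' : K' b = x b 0 + (-b) • x b 1 := by rw [K']; module
  refine ⟨?_, ?_, K_comm_K' b, ?_, ?_, ?_⟩
  · rw [E, mul_smul_comm, smul_mul_assoc, smul_comm (q b)]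
    congr 1
    exact flip h1 (skew_of_comm_anti I_mul_I cE aE)
  · rw [F, mul_smul_comm, smul_mul_assoc, smul_comm (q b)⁻¹, hq]
    congr 1
    refine flip h2 ?_
    have := skew_of_comm_anti hIn cF aF
    rwa [neg_mul, ← sub_eq_add_neg, sub_neg_eq_add] at this
  · rw [E, mul_smul_comm, smul_mul_assoc, smul_comm (q b)⁻¹, hq, eK']
    congr 1
    refine flip h2 ?_
    have := skew_of_comm_anti (b := -b) I_mul_I (by rwa [neg_sq]) aE
    rwa [mul_neg, ← sub_eq_add_neg, sub_neg_eq_add] at this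
  · rw [F, mul_smul_comm, smul_mul_assoc, smul_comm (q b), eK']
    congr 1
    refine flip h1 ?_
    have := skew_of_comm_anti (b := -b) hIn (by rwa [neg_sq]) aF
    rwa [neg_mul_neg] at this
  -- Both sides of the last relation are multiples of `x₀x₁`, because `[x₂, x₃] = {x₀, x₁} = 2x₀x₁`
  -- and `K² - K'² = 4b x₀x₁`; the common coefficient is `i(1 + b²)`.
  · have hq' : (q b - (q b)⁻¹)⁻¹ * (4 * b) = I * (1 + b ^ 2) := by
      have h3 : 1 + b ^ 2 ≠ 0 := by
        have : 1 + b ^ 2 = (1 + I * b) * (1 - I * b) := by linear_combination b ^ 2 * I_sq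
        rw [this]; exact mul_ne_zero h1 h2
      rw [q_sub_inv hb1 hb2, inv_div]
      field_simp
      linear_combination -I_sq
    have hKK : K b ^ 2 - K' b ^ 2 = (4 * b) • (x b 0 * x b 1) := by
      simp only [K, K', pow_two, add_mul, mul_add, sub_mul, mul_sub, smul_mul_assoc,
        mul_smul_comm, h01]
      module
    have hEF : E b * F b - F b * E b =
        (-2 * I * ((I / 2 * (1 - I * b)) * (I / 2 * (1 + I * b)))) •
          (x b 2 * x b 3 - x b 3 * x b 2) := by
      simp only [E, F, add_mul, mul_add, sub_mul, mul_sub, smul_mul_assoc, mul_smul_comm]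
      module
    rw [hKK, smul_smul, hq', hEF, ← a01, ← h01, ← two_smul ℂ, smul_smul]
    congr 1
    linear_combination (-I + I * b ^ 2 * (I ^ 2 - 1)) * I_sq

/-! ### The isomorphism between the two presentations -/

/-- The homomorphism out of `EFKAlgebra q` given by elements that satisfy its relations. -/
noncomputable def EFKAlgebra.lift {q : ℂ} {e f k k' : A} (h : IsEFK q e f k k') :
    EFKAlgebra q →ₐ[ℂ] A :=
  RingQuot.liftAlgHom ℂ ⟨FreeAlgebra.lift ℂ (fun g : Gen => Gen.casesOn g e f k k'), by
    intro _ _ hr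
    cases hr <;>
      simp only [map_mul, map_smul, map_sub, map_pow, FreeAlgebra.lift_ι_apply]
    exacts [h.KE, h.KF, h.KK', h.K'E, h.K'F, h.EF]⟩

theorem EFKAlgebra.lift_gen {q : ℂ} {e f k k' : A} (h : IsEFK q e f k k') (g : Gen) :
    EFKAlgebra.lift h (EFKAlgebra.gen q g) = Gen.casesOn g e f k k' := by
  rw [EFKAlgebra.lift, EFKAlgebra.gen, RingQuot.liftAlgHom_mkAlgHom_apply,
    FreeAlgebra.lift_ι_apply]

theorem isEFK_gen (q : ℂ) : IsEFK q (EFKAlgebra.gen q .E) (EFKAlgebra.gen q .F)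
    (EFKAlgebra.gen q .K) (EFKAlgebra.gen q .K') := by
  have h₁ := RingQuot.mkAlgHom_rel ℂ (EFKRel.KE (q := q))
  have h₂ := RingQuot.mkAlgHom_rel ℂ (EFKRel.KF (q := q))
  have h₃ := RingQuot.mkAlgHom_rel ℂ (EFKRel.KK' (q := q))
  have h₄ := RingQuot.mkAlgHom_rel ℂ (EFKRel.K'E (q := q))
  have h₅ := RingQuot.mkAlgHom_rel ℂ (EFKRel.K'F (q := q))
  have h₆ := RingQuot.mkAlgHom_rel ℂ (EFKRel.EF (q := q))
  simp only [map_mul, map_sub, map_pow, map_smul] at h₁ h₂ h₃ h₄ h₅ h₆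
  exact ⟨h₁, h₂, h₃, h₄, h₅, h₆⟩

theorem EFKAlgebra.hom_ext {q : ℂ} {φ ψ : EFKAlgebra q →ₐ[ℂ] A}
    (h : ∀ g, φ (EFKAlgebra.gen q g) = ψ (EFKAlgebra.gen q g)) : φ = ψ := by
  apply RingQuot.ringQuot_ext'
  ext g
  exact h g

theorem S.hom_ext {b : ℂ} {φ ψ : S b →ₐ[ℂ] A} (h : ∀ i, φ (x b i) = ψ (x b i)) : φ = ψ := by
  apply RingQuot.ringQuot_ext'
  ext i
  exact h i

/-- The elements of an algebra that correspond to `x₀, x₁, x₂, x₃` under the change of generators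
to `E, F, K, K'`. -/
noncomputable def xOfEFK (b : ℂ) (e f k k' : A) : Fin 4 → A :=
  ![(1 / 2 : ℂ) • (k + k'), (1 / (2 * b)) • (k - k'),
    (1 / 2 : ℂ) • ((I / 2 * (1 - I * b))⁻¹ • e + (I / 2 * (1 + I * b))⁻¹ • f),
    (-I / 2) • ((I / 2 * (1 - I * b))⁻¹ • e - (I / 2 * (1 + I * b))⁻¹ • f)]

theorem sklyanin_of_EFK {b : ℂ} (hb0 : b ≠ 0) (hb1 : b ≠ I) (hb2 : b ≠ -I) {e f k k' : A}
    (h : IsEFK (q b) e f k k') ⦃v w : FreeAlgebra ℂ (Fin 4)⦄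
    (hr : SklyaninRel 0 (b ^ 2) (-b ^ 2) v w) :
    FreeAlgebra.lift ℂ (xOfEFK b e f k k') v = FreeAlgebra.lift ℂ (xOfEFK b e f k k') w := by
  have h1 := one_add_I_mul_ne_zero hb1
  have h2 := one_sub_I_mul_ne_zero hb2
  have hI (w : A) : (I * I) • w = -w := by rw [I_mul_I, neg_one_smul]
  have hIn : -I * -I = -1 := by rw [neg_mul_neg, I_mul_I]
  set y := xOfEFK b e f k k'
  have hk : y 0 + b • y 1 = k := by
    change (1 / 2 : ℂ) • (k + k') + b • (1 / (2 * b)) • (k - k') = k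
    match_scalars <;> field_simp <;> ring
  have hk' : y 0 - b • y 1 = k' := by
    change (1 / 2 : ℂ) • (k + k') - b • (1 / (2 * b)) • (k - k') = k'
    match_scalars <;> field_simp <;> ring
  obtain ⟨α, hα⟩ : ∃ α, α = I / 2 * (1 - I * b) := ⟨_, rfl⟩
  obtain ⟨β, hβ⟩ : ∃ β, β = I / 2 * (1 + I * b) := ⟨_, rfl⟩
  -- `ξ` and `η` play the roles of `x₂ + i x₃` and `x₂ - i x₃`. The relations are proved for them
  -- and then recombined into those for `x₂` and `x₃`.
  obtain ⟨ξ, hξ⟩ : ∃ ξ, ξ = α⁻¹ • e := ⟨_, rfl⟩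
  obtain ⟨η, hη⟩ : ∃ η, η = β⁻¹ • f := ⟨_, rfl⟩
  have hy2 : y 2 = (1 / 2 : ℂ) • (ξ + η) := by rw [hξ, hη, hα, hβ]; rfl
  have hy3 : y 3 = (-I / 2) • (ξ - η) := by rw [hξ, hη, hα, hβ]; rfl
  have flip {c d : ℂ} (hc : c ≠ 0) {v w : A} (h : v = (d / c) • w) : c • v = d • w := by
    rw [h, smul_smul, mul_div_cancel₀ _ hc]
  have hq : (q b)⁻¹ = (1 + I * b) / (1 - I * b) := inv_div _ _
  obtain ⟨cξ, aξ⟩ := comm_anti_of_skew (y := ξ) (u := y 0) (v := y 1) I_mul_I hb0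
    (by rw [hk, hξ]
        refine flip h1 ?_
        rw [mul_smul_comm, smul_mul_assoc, h.KE, smul_comm]; rfl)
    (by rw [hk', hξ]
        refine flip h2 ?_
        rw [mul_smul_comm, smul_mul_assoc, h.K'E, hq, smul_comm])
  obtain ⟨cη, aη⟩ := comm_anti_of_skew (y := η) (u := y 0) (v := y 1) hIn hb0
    (by rw [hk, hη, neg_mul, ← sub_eq_add_neg, sub_neg_eq_add]
        refine flip h2 ?_
        rw [mul_smul_comm, smul_mul_assoc, h.KF, hq, smul_comm])
    (by rw [hk', hη, neg_mul, ← sub_eq_add_neg, sub_neg_eq_add]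
        refine flip h1 ?_
        rw [mul_smul_comm, smul_mul_assoc, h.K'F, smul_comm]; rfl)
  have h01 : y 0 * y 1 = y 1 * y 0 := by
    change ((1 / 2 : ℂ) • (k + k')) * ((1 / (2 * b)) • (k - k')) =
      ((1 / (2 * b)) • (k - k')) * ((1 / 2 : ℂ) • (k + k'))
    simp only [smul_mul_assoc, mul_smul_comm, add_mul, mul_add, sub_mul, mul_sub, h.KK']
    module
  cases hr <;>
    simp only [map_mul, map_smul, map_sub, map_add, FreeAlgebra.lift_ι_apply, zero_smul]
  · rw [h01, sub_self, map_zero]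
  · rw [hy2, hy3]
    simp only [smul_mul_assoc, mul_smul_comm, add_mul, mul_add, sub_mul, mul_sub] at cξ cη ⊢
    linear_combination (norm := module) (1 / 2 : ℂ) • (cξ + cη)
  · rw [hy2, hy3]
    simp only [smul_mul_assoc, mul_smul_comm, add_mul, mul_add, sub_mul, mul_sub] at cξ cη ⊢
    linear_combination (norm := module) (-I / 2) • (cξ - cη) + (b ^ 2 / 2) •
      hI (y 1 * ξ + ξ * y 1 + y 1 * η + η * y 1)
  · have hEF : y 2 * y 3 - y 3 * y 2 = (I / 2 * (α⁻¹ * β⁻¹)) • (e * f - f * e) := by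
      rw [hy2, hy3, hξ, hη]
      simp only [smul_mul_assoc, mul_smul_comm, add_mul, mul_add, sub_mul, mul_sub]
      module
    have hKK : k ^ 2 - k' ^ 2 = (4 * b) • (y 0 * y 1) := by
      rw [← hk, ← hk']
      simp only [pow_two, smul_mul_assoc, mul_smul_comm, add_mul, mul_add, sub_mul, mul_sub, h01]
      module
    have h3 : 1 + b ^ 2 = (1 + I * b) * (1 - I * b) := by linear_combination b ^ 2 * I_sq
    -- The value 2 is what `{x₀, x₁} = 2x₀x₁` requires.
    have hc : I / 2 * (α⁻¹ * β⁻¹) * ((q b - (q b)⁻¹)⁻¹ * (4 * b)) = 2 := by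
      rw [q_sub_inv hb1 hb2, inv_div, hα, hβ, h3]
      field_simp
      linear_combination -I_sq
    rw [hEF, h.EF, hKK, smul_smul, smul_smul, mul_assoc, hc, ← h01, two_smul]
  · rw [hy2, hy3]
    simp only [smul_mul_assoc, mul_smul_comm, add_mul, mul_add, sub_mul, mul_sub] at aξ aη ⊢
    linear_combination (norm := module) (1 / 2 : ℂ) • (aξ + aη)
  · rw [hy2, hy3]
    simp only [smul_mul_assoc, mul_smul_comm, add_mul, mul_add, sub_mul, mul_sub] at aξ aη ⊢
    linear_combination (norm := module) (-I / 2) • (aξ - aη) - (1 / 2 : ℂ) •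
      hI (y 1 * ξ - ξ * y 1 + y 1 * η - η * y 1)

/-- The homomorphism out of `S` given by elements that satisfy the relations `EFKRel`. -/
noncomputable def S.lift {b : ℂ} (hb0 : b ≠ 0) (hb1 : b ≠ I) (hb2 : b ≠ -I) {e f k k' : A}
    (h : IsEFK (q b) e f k k') : S b →ₐ[ℂ] A :=
  RingQuot.liftAlgHom ℂ ⟨FreeAlgebra.lift ℂ (xOfEFK b e f k k'), sklyanin_of_EFK hb0 hb1 hb2 h⟩

section lift

variable {b : ℂ} (hb0 : b ≠ 0) (hb1 : b ≠ I) (hb2 : b ≠ -I) {e f k k' : A}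
  (h : IsEFK (q b) e f k k')

theorem S.lift_x (i : Fin 4) : S.lift hb0 hb1 hb2 h (x b i) = xOfEFK b e f k k' i := by
  rw [S.lift, x, RingQuot.liftAlgHom_mkAlgHom_apply, FreeAlgebra.lift_ι_apply]

theorem S.lift_K : S.lift hb0 hb1 hb2 h (K b) = k := by
  rw [K, map_add, map_smul, lift_x, lift_x]
  change (1 / 2 : ℂ) • (k + k') + b • (1 / (2 * b)) • (k - k') = k
  match_scalars <;> field_simp <;> ring

theorem S.lift_K' : S.lift hb0 hb1 hb2 h (K' b) = k' := by
  rw [K', map_sub, map_smul, lift_x, lift_x]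
  change (1 / 2 : ℂ) • (k + k') - b • (1 / (2 * b)) • (k - k') = k'
  match_scalars <;> field_simp <;> ring

theorem S.lift_E : S.lift hb0 hb1 hb2 h (E b) = e := by
  have hα : I / 2 * (1 - I * b) ≠ 0 := mul_ne_zero (by simp) (one_sub_I_mul_ne_zero hb2)
  rw [E, map_smul, map_add, map_smul, lift_x, lift_x]
  change _ • ((1 / 2 : ℂ) • ((I / 2 * (1 - I * b))⁻¹ • e + (I / 2 * (1 + I * b))⁻¹ • f) +
    I • (-I / 2) • ((I / 2 * (1 - I * b))⁻¹ • e - (I / 2 * (1 + I * b))⁻¹ • f)) = _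
  rw [smul_smul I, show I * (-I / 2) = 1 / 2 by linear_combination (-1 / 2 : ℂ) * I_sq,
    ← smul_add, add_add_sub_cancel, ← two_smul ℂ, smul_smul (1 / 2 : ℂ), one_div,
    inv_mul_cancel₀ two_ne_zero, one_smul, smul_inv_smul₀ hα]

theorem S.lift_F : S.lift hb0 hb1 hb2 h (F b) = f := by
  have hβ : I / 2 * (1 + I * b) ≠ 0 := mul_ne_zero (by simp) (one_add_I_mul_ne_zero hb1)
  rw [F, map_smul, map_sub, map_smul, lift_x, lift_x]
  change _ • ((1 / 2 : ℂ) • ((I / 2 * (1 - I * b))⁻¹ • e + (I / 2 * (1 + I * b))⁻¹ • f) -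
    I • (-I / 2) • ((I / 2 * (1 - I * b))⁻¹ • e - (I / 2 * (1 + I * b))⁻¹ • f)) = _
  rw [smul_smul I, show I * (-I / 2) = 1 / 2 by linear_combination (-1 / 2 : ℂ) * I_sq,
    ← smul_sub, add_sub_sub_cancel, ← two_smul ℂ, smul_smul (1 / 2 : ℂ), one_div,
    inv_mul_cancel₀ two_ne_zero, one_smul, smul_inv_smul₀ hβ]

end lift

/-- The generators `x₀, x₁, x₂, x₃` of `S` are recovered from `E, F, K, K'`. -/
theorem xOfEFK_self {b : ℂ} (hb0 : b ≠ 0) (hb1 : b ≠ I) (hb2 : b ≠ -I) (i : Fin 4) :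
    xOfEFK b (E b) (F b) (K b) (K' b) i = x b i := by
  have hα : I / 2 * (1 - I * b) ≠ 0 := mul_ne_zero (by simp) (one_sub_I_mul_ne_zero hb2)
  have hβ : I / 2 * (1 + I * b) ≠ 0 := mul_ne_zero (by simp) (one_add_I_mul_ne_zero hb1)
  have hI (w : S b) : (I * I) • w = -w := by rw [I_mul_I]; module
  fin_cases i
  · change (1 / 2 : ℂ) • (K b + K' b) = x b 0
    rw [K, K']; module
  · change (1 / (2 * b)) • (K b - K' b) = x b 1
    rw [K, K']
    match_scalars <;> field_simp <;> ring
  · change (1 / 2 : ℂ) • ((I / 2 * (1 - I * b))⁻¹ • E b + (I / 2 * (1 + I * b))⁻¹ • F b) = x b 2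
    rw [E, F, inv_smul_smul₀ hα, inv_smul_smul₀ hβ]
    module
  · change (-I / 2) • ((I / 2 * (1 - I * b))⁻¹ • E b - (I / 2 * (1 + I * b))⁻¹ • F b) = x b 3
    rw [E, F, inv_smul_smul₀ hα, inv_smul_smul₀ hβ]
    linear_combination (norm := module) -hI (x b 3)

/-- The isomorphism between the algebra presented by `E, F, K, K'` and `S`. -/
noncomputable def efkEquiv {b : ℂ} (hb0 : b ≠ 0) (hb1 : b ≠ I) (hb2 : b ≠ -I) :
    EFKAlgebra (q b) ≃ₐ[ℂ] S b :=
  AlgEquiv.ofAlgHom (EFKAlgebra.lift (isEFK_S hb0 hb1 hb2))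
    (S.lift hb0 hb1 hb2 (isEFK_gen (q b)))
    (S.hom_ext fun i => by
      rw [AlgHom.comp_apply, S.lift_x, AlgHom.id_apply]
      refine Eq.trans ?_ (xOfEFK_self hb0 hb1 hb2 i)
      fin_cases i <;> simp [xOfEFK, EFKAlgebra.lift_gen])
    (EFKAlgebra.hom_ext fun g => by
      rw [AlgHom.comp_apply, EFKAlgebra.lift_gen, AlgHom.id_apply]
      cases g
      exacts [S.lift_E .., S.lift_F .., S.lift_K .., S.lift_K' ..])

/-! ### `U_q(sl₂)`: universal property and rescaling automorphisms -/

/-- Elements `e, f, k, k⁻¹` of an algebra that satisfy the relations `UqRel q`. -/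
structure IsUq (q : ℂ) (e f k kinv : A) : Prop where
  ke : k * e = q ^ 2 • (e * k)
  kf : k * f = (q ^ 2)⁻¹ • (f * k)
  k_kinv : k * kinv = 1
  kinv_k : kinv * k = 1
  ef : e * f - f * e = (q - q⁻¹)⁻¹ • (k - kinv)

/-- The homomorphism out of `U_q(sl₂)` given by elements that satisfy its relations. -/
noncomputable def Uq.lift {q : ℂ} {e f k kinv : A} (h : IsUq q e f k kinv) : Uq q →ₐ[ℂ] A :=
  RingQuot.liftAlgHom ℂ ⟨FreeAlgebra.lift ℂ (fun g : UGen => UGen.casesOn g e f k kinv), by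
    intro _ _ hr
    cases hr <;>
      simp only [map_mul, map_smul, map_sub, map_one, FreeAlgebra.lift_ι_apply]
    exacts [h.ke, h.kf, h.k_kinv, h.kinv_k, h.ef]⟩

theorem Uq.lift_gen {q : ℂ} {e f k kinv : A} (h : IsUq q e f k kinv) (g : UGen) :
    Uq.lift h (Uq.gen q g) = UGen.casesOn g e f k kinv := by
  rw [Uq.lift, Uq.gen, RingQuot.liftAlgHom_mkAlgHom_apply, FreeAlgebra.lift_ι_apply]

theorem isUq_gen (q : ℂ) : IsUq q (Uq.gen q .e) (Uq.gen q .f) (Uq.gen q .k)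
    (Uq.gen q .kinv) := by
  have h₁ := RingQuot.mkAlgHom_rel ℂ (UqRel.ke (q := q))
  have h₂ := RingQuot.mkAlgHom_rel ℂ (UqRel.kf (q := q))
  have h₃ := RingQuot.mkAlgHom_rel ℂ (UqRel.k_kinv (q := q))
  have h₄ := RingQuot.mkAlgHom_rel ℂ (UqRel.kinv_k (q := q))
  have h₅ := RingQuot.mkAlgHom_rel ℂ (UqRel.ef (q := q))
  simp only [map_mul, map_sub, map_one, map_smul] at h₁ h₂ h₃ h₄ h₅
  exact ⟨h₁, h₂, h₃, h₄, h₅⟩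

theorem Uq.hom_ext {A : Type*} [Semiring A] [Algebra ℂ A] {q : ℂ} {φ ψ : Uq q →ₐ[ℂ] A}
    (h : ∀ g, φ (Uq.gen q g) = ψ (Uq.gen q g)) : φ = ψ := by
  apply RingQuot.ringQuot_ext'
  ext g
  exact h g

/-- Twisted commutation with a fixed `t` passes to sums and products, so generators suffice. It is
applied with `t = K` and `ψ` equal to `φ` after a rescaling. -/
theorem Uq.semiconjBy {q : ℂ} {φ ψ : Uq q →ₐ[ℂ] A} {t : A}
    (h : ∀ g, SemiconjBy t (φ (Uq.gen q g)) (ψ (Uq.gen q g))) (u : Uq q) :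
    SemiconjBy t (φ u) (ψ u) := by
  obtain ⟨w, rfl⟩ := RingQuot.mkAlgHom_surjective ℂ (UqRel q) u
  induction w using FreeAlgebra.induction with
  | grade0 c =>
    rw [AlgHom.commutes, AlgHom.commutes, AlgHom.commutes]
    exact (Algebra.commutes c t).symm
  | grade1 g => exact h g
  | mul u v hu hv => rw [map_mul, map_mul, map_mul]; exact hu.mul_right hv
  | add u v hu hv => rw [map_add, map_add, map_add]; exact hu.add_right hv

theorem IsUq.kinv_e {q : ℂ} (hq : q ≠ 0) {e f k kinv : A} (h : IsUq q e f k kinv) :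
    kinv * e = (q ^ 2)⁻¹ • (e * kinv) := by
  have : kinv * (k * e) * kinv = q ^ 2 • (kinv * e) := by
    rw [h.ke, mul_smul_comm, smul_mul_assoc, mul_assoc, mul_assoc, h.k_kinv, mul_one]
  rw [← mul_assoc, h.kinv_k, one_mul] at this
  rw [this, inv_smul_smul₀ (pow_ne_zero 2 hq)]

theorem IsUq.kinv_f {q : ℂ} (hq : q ≠ 0) {e f k kinv : A} (h : IsUq q e f k kinv) :
    kinv * f = q ^ 2 • (f * kinv) := by
  have : kinv * (k * f) * kinv = (q ^ 2)⁻¹ • (kinv * f) := by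
    rw [h.kf, mul_smul_comm, smul_mul_assoc, mul_assoc, mul_assoc, h.k_kinv, mul_one]
  rw [← mul_assoc, h.kinv_k, one_mul] at this
  rw [this, smul_inv_smul₀ (pow_ne_zero 2 hq)]

theorem IsUq.rescale {q c : ℂ} (hc : c ≠ 0) {e f k kinv : A} (h : IsUq q e f k kinv) :
    IsUq q (c • e) (c⁻¹ • f) k kinv where
  ke := by rw [mul_smul_comm, h.ke, smul_mul_assoc, smul_comm]
  kf := by rw [mul_smul_comm, h.kf, smul_mul_assoc, smul_comm]
  k_kinv := h.k_kinv
  kinv_k := h.kinv_k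
  ef := by
    rw [smul_mul_smul_comm, smul_mul_smul_comm, mul_inv_cancel₀ hc, inv_mul_cancel₀ hc,
      one_smul, one_smul, h.ef]

/-- The endomorphism of `U_q(sl₂)` with `e ↦ c e`, `f ↦ c⁻¹ f` and `k ↦ k`. -/
noncomputable def Uq.rescale (q : ℂ) {c : ℂ} (hc : c ≠ 0) : Uq q →ₐ[ℂ] Uq q :=
  Uq.lift ((isUq_gen q).rescale hc)

theorem Uq.rescale_comp_inv (q : ℂ) {c d : ℂ} (hc : c ≠ 0) (hd : d ≠ 0) (hcd : c * d = 1) :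
    (Uq.rescale q hc).comp (Uq.rescale q hd) = AlgHom.id ℂ (Uq q) := by
  have hdc : d⁻¹ * c⁻¹ = 1 := by rw [← mul_inv, mul_comm, hcd, inv_one]
  apply Uq.hom_ext
  intro g
  cases g <;> simp only [Uq.rescale, AlgHom.comp_apply, Uq.lift_gen, map_smul, AlgHom.id_apply]
  · rw [smul_smul, mul_comm, hcd, one_smul]
  · rw [smul_smul, hdc, one_smul]

/-! ### From `E, F, K, K'` to `U_q(sl₂)`, and back by operators on `U_q(sl₂)` -/

/-- In an algebra in which `K` and `K'` are invertible, elements satisfying the relations of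
`E, F, K, K'` give rise to elements satisfying the relations of `U_q(sl₂)`. -/
theorem IsEFK.isUq {q r : ℂ} (hr : r ^ 2 = q) (hq : q ≠ 0) {e f : A} {k k' : Aˣ}
    (h : IsEFK q e f k k') :
    IsUq q (r⁻¹ • (e * ↑k⁻¹)) (r⁻¹ • (f * ↑k'⁻¹)) (k * ↑k'⁻¹) (k' * ↑k⁻¹) := by
  have flip {u : Aˣ} {y : A} {c : ℂ} (hc : c ≠ 0) (hu : u * y = c • (y * u)) :
      ↑u⁻¹ * y = c⁻¹ • (y * ↑u⁻¹) := by
    have : (↑u⁻¹ : A) * (u * y) * ↑u⁻¹ = c • (↑u⁻¹ * y) := by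
      rw [hu, mul_smul_comm, smul_mul_assoc, mul_assoc, mul_assoc, Units.mul_inv, mul_one]
    rw [← mul_assoc, Units.inv_mul, one_mul] at this
    rw [this, inv_smul_smul₀ hc]
  have ckk : Commute k k' := Units.ext h.KK'
  have cA : Commute (k * k'⁻¹) k⁻¹ :=
    ((Commute.refl k).mul_left ckk.symm.inv_left).inv_right
  have cB : Commute (k * k'⁻¹) k'⁻¹ :=
    (ckk.mul_left ((Commute.refl k').inv_left)).inv_right
  have cA' : (k : A) * ↑k'⁻¹ * ↑k⁻¹ = ↑k⁻¹ * (k * ↑k'⁻¹) := by exact_mod_cast congrArg Units.val cA.eq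
  have cB' : (k : A) * ↑k'⁻¹ * ↑k'⁻¹ = ↑k'⁻¹ * (k * ↑k'⁻¹) := by
    exact_mod_cast congrArg Units.val cB.eq
  have hKF := flip (inv_ne_zero hq) h.KF
  have hK'E := flip (inv_ne_zero hq) h.K'E
  have hK'F := flip hq h.K'F
  rw [inv_inv] at hKF hK'E
  -- This is where `√q` comes from: moving `K⁻¹` past `F`, or `K'⁻¹` past `E`, costs a factor `q`,
  -- which the two factors `r⁻¹` cancel.
  have hr0 : r⁻¹ * r⁻¹ * q = 1 := by
    have : r ≠ 0 := by rintro rfl; exact hq (by rw [← hr]; ring)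
    rw [← hr]; field_simp
  refine ⟨?_, ?_, ?_, ?_, ?_⟩
  · have : (k * ↑k'⁻¹ : A) * e = q ^ 2 • (e * (k * ↑k'⁻¹)) := by
      rw [mul_assoc, hK'E, mul_smul_comm, ← mul_assoc, h.KE, smul_mul_assoc, smul_smul, pow_two,
        mul_assoc]
    rw [mul_smul_comm, smul_mul_assoc, smul_comm (q ^ 2), ← mul_assoc, this, smul_mul_assoc,
      mul_assoc e, cA', mul_assoc e]
  · have : (k * ↑k'⁻¹ : A) * f = (q ^ 2)⁻¹ • (f * (k * ↑k'⁻¹)) := by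
      rw [mul_assoc, hK'F, mul_smul_comm, ← mul_assoc, h.KF, smul_mul_assoc, smul_smul, pow_two,
        mul_inv, mul_assoc]
    rw [mul_smul_comm, smul_mul_assoc, smul_comm (q ^ 2)⁻¹, ← mul_assoc, this, smul_mul_assoc,
      mul_assoc f, cB', mul_assoc f]
  · rw [mul_assoc, ← mul_assoc (↑k'⁻¹ : A), Units.inv_mul, one_mul, Units.mul_inv]
  · rw [mul_assoc, ← mul_assoc (↑k⁻¹ : A), Units.inv_mul, one_mul, Units.mul_inv]
  · have hinv : (↑k'⁻¹ : A) * ↑k⁻¹ = ↑k⁻¹ * ↑k'⁻¹ := by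
      exact_mod_cast congrArg Units.val ckk.symm.inv_inv.eq
    have hK2 : (k : A) ^ 2 * (↑k⁻¹ * ↑k'⁻¹) = k * ↑k'⁻¹ := by
      rw [pow_two, mul_assoc, ← mul_assoc (k : A) ↑k⁻¹, Units.mul_inv, one_mul]
    have hK'2 : (k' : A) ^ 2 * (↑k⁻¹ * ↑k'⁻¹) = k' * ↑k⁻¹ := by
      rw [← hinv, pow_two, mul_assoc, ← mul_assoc (k' : A) ↑k'⁻¹, Units.mul_inv, one_mul]
    have h1 : e * ↑k⁻¹ * (f * ↑k'⁻¹) = q • (e * f * (↑k⁻¹ * ↑k'⁻¹)) := by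
      rw [mul_assoc, ← mul_assoc (↑k⁻¹ : A), hKF, smul_mul_assoc, mul_smul_comm]
      simp only [mul_assoc]
    have h2 : f * ↑k'⁻¹ * (e * ↑k⁻¹) = q • (f * e * (↑k⁻¹ * ↑k'⁻¹)) := by
      rw [mul_assoc, ← mul_assoc (↑k'⁻¹ : A), hK'E, smul_mul_assoc, mul_smul_comm, ← hinv]
      simp only [mul_assoc]
    rw [smul_mul_smul_comm, smul_mul_smul_comm, h1, h2, smul_smul, smul_smul, hr0, one_smul,
      one_smul, ← sub_mul, h.EF, smul_mul_assoc, sub_mul, hK2, hK'2]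

/-- `S` acts on `U_q(sl₂)`, with `K` acting as the automorphism `e ↦ q e`, `f ↦ q⁻¹ f` and
`E K⁻¹`, `F K'⁻¹`, `K K'⁻¹` as left multiplications. -/
theorem isEFK_end {q r : ℂ} (hr : r ^ 2 = q) (hq : q ≠ 0) :
    IsEFK q
      (Algebra.lmul ℂ (Uq q) (r • Uq.gen q .e) * (Uq.rescale q hq).toLinearMap)
      (Algebra.lmul ℂ (Uq q) (r • (Uq.gen q .f * Uq.gen q .kinv)) *
        (Uq.rescale q hq).toLinearMap)
      ((Uq.rescale q hq).toLinearMap : Module.End ℂ (Uq q))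
      (Algebra.lmul ℂ (Uq q) (Uq.gen q .kinv) * (Uq.rescale q hq).toLinearMap) := by
  have h := isUq_gen q
  have hkf := h.kinv_f hq
  have hke := h.kinv_e hq
  have σe : Uq.rescale q hq (Uq.gen q .e) = q • Uq.gen q .e := Uq.lift_gen ..
  have σf : Uq.rescale q hq (Uq.gen q .f) = q⁻¹ • Uq.gen q .f := Uq.lift_gen ..
  have σk : Uq.rescale q hq (Uq.gen q .kinv) = Uq.gen q .kinv := Uq.lift_gen ..
  generalize Uq.gen q .e = e at *
  generalize Uq.gen q .f = f at *
  generalize Uq.gen q .k = k at *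
  generalize Uq.gen q .kinv = k' at *
  -- Straightening rules with a trailing factor `z`, so that they rewrite inside right-nested
  -- products: `e` moves right past `f`, and `k⁻¹` moves right past both.
  have hef (z : Uq q) : e * (f * z) = f * (e * z) + (q - q⁻¹)⁻¹ • (k * z - k' * z) := by
    linear_combination (norm := (simp only [sub_mul, mul_assoc, smul_mul_assoc]; module))
      congrArg (· * z) h.ef
  have hke' (z : Uq q) : k' * (e * z) = (q ^ 2)⁻¹ • (e * (k' * z)) := by
    rw [← mul_assoc, hke, smul_mul_assoc, mul_assoc]
  have hkf' (z : Uq q) : k' * (f * z) = (q ^ 2) • (f * (k' * z)) := by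
    rw [← mul_assoc, hkf, smul_mul_assoc, mul_assoc]
  have hkk (z : Uq q) : k * (k' * z) = z := by rw [← mul_assoc, h.k_kinv, one_mul]
  have hL (a z : Uq q) : Algebra.lmul ℂ (Uq q) a z = a * z := rfl
  have hsq (T : Module.End ℂ (Uq q)) (z : Uq q) : (T ^ 2) z = T (T z) := by rw [pow_two]; rfl
  have hrr : r * r = q := by rw [← hr, pow_two]
  constructor <;> refine LinearMap.ext fun z => ?_ <;>
    simp only [Module.End.mul_apply, LinearMap.sub_apply, LinearMap.smul_apply, hsq, hL,
      AlgHom.toLinearMap_apply, map_mul, map_smul, σe, σf, σk, smul_mul_assoc, mul_smul_comm,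
      mul_assoc, hke', hkf', hef, hkk]
  · module
  · module
  · match_scalars; field_simp
  · match_scalars; field_simp
  -- The identity is linear in this scalar and holds for any value of it, so `q² ≠ 1` is not needed.
  · generalize (q - q⁻¹)⁻¹ = d
    match_scalars <;> field_simp
    · ring
    · linear_combination d * hrr
    · linear_combination -d * hrr

/-! ### The localization and its degree-zero elements -/

/-- The canonical map `S → S[(KK')⁻¹]` as a homomorphism of algebras. -/
noncomputable def toLocAlg (b : ℂ) : S b →ₐ[ℂ] SLoc b :=
  { toLoc b with commutes' := fun _ => rfl }

theorem isEFK_SLoc {b : ℂ} (hb0 : b ≠ 0) (hb1 : b ≠ I) (hb2 : b ≠ -I) :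
    IsEFK (q b) (toLoc b (E b)) (toLoc b (F b)) (unitK b : SLoc b) (unitK' b : SLoc b) :=
   IsEFK.map (B := SLoc b) (isEFK_S hb0 hb1 hb2) (toLocAlg b)

section extend

variable {b : ℂ}

/-- The extension to `S[(KK')⁻¹]` of a homomorphism that maps `KK'` to a unit. -/
noncomputable def extendLoc (ρ : S b →ₐ[ℂ] A) (h : IsUnit (ρ (K b * K' b))) : SLoc b →ₐ[ℂ] A :=
  have hu (t : powersKK' b) : IsUnit ((ρ : S b →* A).comp (powersKK' b).subtype t) := by
    obtain ⟨_, n, rfl⟩ := t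
    change IsUnit (ρ ((K b * K' b) ^ n))
    rw [map_pow]
    exact h.pow n
  { universalHom (ρ : S b →+* A) (IsUnit.liftRight _ hu) (fun _ => rfl) with
    commutes' := fun c => (universalHom_commutes _ _ _).trans (ρ.commutes c) }

theorem extendLoc_toLoc (ρ : S b →ₐ[ℂ] A) (h : IsUnit (ρ (K b * K' b))) (s : S b) :
    extendLoc ρ h (toLoc b s) = ρ s :=
  universalHom_commutes _ _ _

end extend

theorem oreDiv_powKK'_one (b : ℂ) (s : S b) : s /ₒ powKK' b 1 = toLoc b s * invKK' b := by
  rw [← invKK'_comm]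
  change _ = (1 : S b) /ₒ powKK' b 1 * (s /ₒ 1)
  rw [OreLocalization.mul_div_one, one_mul]

/-- The inverses of `K` and `K'` are by definition `K'(KK')⁻¹` and `K(KK')⁻¹`, so `EK⁻¹`, `FK'⁻¹`
and the like are definitionally of this shape. -/
theorem mul_invKK'_mem (b : ℂ) {s t : S b} (hs : s ∈ component b 1) (ht : t ∈ component b 1) :
    toLoc b s * (toLoc b t * invKK' b) ∈ SLocZero b :=
  ⟨1, s * t, component_mul_mem b (m := 1) (n := 1) hs ht, by rw [oreDiv_powKK'_one, map_mul, mul_assoc]⟩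

theorem x_mem_component (b : ℂ) (i : Fin 4) : x b i ∈ component b 1 := by
  rw [component, pow_one]; exact x_mem b i

theorem E_mem (b : ℂ) : E b ∈ component b 1 :=
  Submodule.smul_mem _ _ (add_mem (x_mem_component b 2)
    (Submodule.smul_mem _ _ (x_mem_component b 3)))

theorem F_mem (b : ℂ) : F b ∈ component b 1 :=
  Submodule.smul_mem _ _ (sub_mem (x_mem_component b 2)
    (Submodule.smul_mem _ _ (x_mem_component b 3)))

theorem K_mem (b : ℂ) : K b ∈ component b 1 :=
  add_mem (x_mem_component b 0) (Submodule.smul_mem _ _ (x_mem_component b 1))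

theorem K'_mem (b : ℂ) : K' b ∈ component b 1 :=
  sub_mem (x_mem_component b 0) (Submodule.smul_mem _ _ (x_mem_component b 1))

/-! ### `U_q(sl₂)` as the degree-zero part -/

section iso

variable {b : ℂ} (hb0 : b ≠ 0) (hb1 : b ≠ I) (hb2 : b ≠ -I) {r : ℂ} (hr : r ^ 2 = q b)

/-- The homomorphism `U_q(sl₂) → S[(KK')⁻¹]` with `√q e ↦ E K⁻¹`, `√q f ↦ F K'⁻¹` and
`k ↦ K K'⁻¹`. -/
noncomputable def uqToSLoc : Uq (q b) →ₐ[ℂ] SLoc b :=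
  Uq.lift ((isEFK_SLoc hb0 hb1 hb2).isUq hr (q_ne_zero hb1 hb2))

/-- The action of `S[(KK')⁻¹]` on `U_q(sl₂)` that extends `isEFK_end`. -/
noncomputable def slocAction : SLoc b →ₐ[ℂ] Module.End ℂ (Uq (q b)) :=
  extendLoc (S.lift hb0 hb1 hb2 (isEFK_end hr (q_ne_zero hb1 hb2))) (by
    have hq := q_ne_zero hb1 hb2
    have hσ : IsUnit ((Uq.rescale (q b) hq).toLinearMap : Module.End ℂ (Uq (q b))) := by
      refine ⟨⟨_, (Uq.rescale (q b) (inv_ne_zero hq)).toLinearMap, ?_, ?_⟩, rfl⟩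
      · exact congrArg AlgHom.toLinearMap
          (Uq.rescale_comp_inv (q b) hq (inv_ne_zero hq) (mul_inv_cancel₀ hq))
      · exact congrArg AlgHom.toLinearMap
          (Uq.rescale_comp_inv (q b) (inv_ne_zero hq) hq (inv_mul_cancel₀ hq))
    have hk : IsUnit (Uq.gen (q b) .kinv) :=
      ⟨⟨_, _, (isUq_gen (q b)).kinv_k, (isUq_gen (q b)).k_kinv⟩, rfl⟩
    rw [map_mul, S.lift_K, S.lift_K']
    exact hσ.mul ((hk.map (Algebra.lmul ℂ (Uq (q b)))).mul hσ))

theorem ne_zero_of_sq_eq_q {b : ℂ} (hb1 : b ≠ I) (hb2 : b ≠ -I) {r : ℂ} (hr : r ^ 2 = q b) :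
    r ≠ 0 := by
  rintro rfl
  exact q_ne_zero hb1 hb2 (by rw [← hr]; ring)

/-- Elements of `U_q(sl₂)` act by left multiplication. -/
theorem slocAction_comp_uqToSLoc :
    (slocAction hb0 hb1 hb2 hr).comp (uqToSLoc hb0 hb1 hb2 hr) = Algebra.lmul ℂ (Uq (q b)) := by
  have hr0 := ne_zero_of_sq_eq_q hb1 hb2 hr
  have ρE : slocAction hb0 hb1 hb2 hr (toLoc b (E b)) = _ :=
    (extendLoc_toLoc _ _ _).trans (S.lift_E ..)
  have ρF : slocAction hb0 hb1 hb2 hr (toLoc b (F b)) = _ :=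
    (extendLoc_toLoc _ _ _).trans (S.lift_F ..)
  have ρK : slocAction hb0 hb1 hb2 hr (toLoc b (K b)) = _ :=
    (extendLoc_toLoc _ _ _).trans (S.lift_K ..)
  have ρK' : slocAction hb0 hb1 hb2 hr (toLoc b (K' b)) = _ :=
    (extendLoc_toLoc _ _ _).trans (S.lift_K' ..)
  -- The action of a fraction `wu⁻¹` is found without inverting operators: it suffices to factor the
  -- action of `w` through that of `u`.
  have key {w : SLoc b} {u : (SLoc b)ˣ} {v : Module.End ℂ (Uq (q b))}
      (h : slocAction hb0 hb1 hb2 hr w = v * slocAction hb0 hb1 hb2 hr u) :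
      slocAction hb0 hb1 hb2 hr (w * ↑u⁻¹) = v := by
    rw [map_mul, h, mul_assoc, ← map_mul, Units.mul_inv, map_one, mul_one]
  refine Uq.hom_ext (A := Module.End ℂ (Uq (q b))) ?_
  intro g
  rw [AlgHom.comp_apply, uqToSLoc, Uq.lift_gen]
  cases g
  · rw [map_smul, key (u := unitK b) (v := r • Algebra.lmul ℂ (Uq (q b)) (Uq.gen (q b) .e)),
      inv_smul_smul₀ hr0]
    change _ = _ * slocAction hb0 hb1 hb2 hr (toLoc b (K b))
    rw [ρE, ρK, map_smul]
  · rw [map_smul, key (u := unitK' b) (v := r • Algebra.lmul ℂ (Uq (q b)) (Uq.gen (q b) .f)),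
      inv_smul_smul₀ hr0]
    change _ = _ * slocAction hb0 hb1 hb2 hr (toLoc b (K' b))
    rw [ρF, ρK', map_smul, map_mul, smul_mul_assoc, smul_mul_assoc, mul_assoc]
  · apply key
    change slocAction hb0 hb1 hb2 hr (toLoc b (K b)) =
      _ * slocAction hb0 hb1 hb2 hr (toLoc b (K' b))
    rw [ρK, ρK', ← mul_assoc, ← map_mul, (isUq_gen (q b)).k_kinv, map_one, one_mul]
  · apply key
    change slocAction hb0 hb1 hb2 hr (toLoc b (K' b)) =
      _ * slocAction hb0 hb1 hb2 hr (toLoc b (K b))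
    rw [ρK, ρK']

/-- Acting on `1 ∈ U_q(sl₂)` recovers `u` from its image. -/
theorem uqToSLoc_injective : Function.Injective (uqToSLoc hb0 hb1 hb2 hr) := by
  intro u v huv
  have h := congrArg (fun z => slocAction hb0 hb1 hb2 hr z 1) huv
  have hL (w : Uq (q b)) :
      slocAction hb0 hb1 hb2 hr (uqToSLoc hb0 hb1 hb2 hr w) 1 = w := by
    rw [← AlgHom.comp_apply, slocAction_comp_uqToSLoc]
    exact mul_one w
  simpa only [hL] using h

theorem uqToSLoc_mem (u : Uq (q b)) : uqToSLoc hb0 hb1 hb2 hr u ∈ SLocZero b := by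
  obtain ⟨w, rfl⟩ := RingQuot.mkAlgHom_surjective ℂ (UqRel (q b)) u
  induction w using FreeAlgebra.induction with
  | grade0 c => rw [AlgHom.commutes, AlgHom.commutes]; exact (SLocZero b).algebraMap_mem c
  | grade1 g =>
    change uqToSLoc hb0 hb1 hb2 hr (Uq.gen (q b) g) ∈ SLocZero b
    rw [uqToSLoc, Uq.lift_gen]
    cases g
    · exact (SLocZero b).smul_mem (mul_invKK'_mem b (E_mem b) (K'_mem b)) _
    · exact (SLocZero b).smul_mem (mul_invKK'_mem b (F_mem b) (K_mem b)) _
    · exact mul_invKK'_mem b (K_mem b) (K_mem b)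
    · exact mul_invKK'_mem b (K'_mem b) (K'_mem b)
  | mul u v hu hv => rw [map_mul, map_mul]; exact mul_mem hu hv
  | add u v hu hv => rw [map_add, map_add]; exact add_mem hu hv

/-- Conjugation by `K` preserves the image of `U_q(sl₂)`; this lets powers of `K` be collected on
the right. -/
theorem uqToSLoc_semiconjBy (u : Uq (q b)) :
    SemiconjBy (toLoc b (K b)) (uqToSLoc hb0 hb1 hb2 hr u)
      (uqToSLoc hb0 hb1 hb2 hr (Uq.rescale (q b) (q_ne_zero hb1 hb2) u)) := by
  have h := isEFK_SLoc hb0 hb1 hb2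
  have cK : SemiconjBy (unitK b : SLoc b) (↑(unitK b)⁻¹) (↑(unitK b)⁻¹) := by
    rw [SemiconjBy, Units.mul_inv, Units.inv_mul]
  have cKK' : SemiconjBy (unitK b) (unitK' b) (unitK' b) := Units.ext h.KK'
  have cK' : SemiconjBy (unitK b : SLoc b) (↑(unitK' b)⁻¹) (↑(unitK' b)⁻¹) :=
    congrArg Units.val cKK'.inv_right.eq
  change SemiconjBy (unitK b : SLoc b) _ 
    ((uqToSLoc hb0 hb1 hb2 hr).comp (Uq.rescale (q b) (q_ne_zero hb1 hb2)) u)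
  refine Uq.semiconjBy (A := SLoc b) (fun g => ?_) u
  rw [AlgHom.comp_apply, Uq.rescale, Uq.lift_gen, uqToSLoc]
  cases g <;> simp only [map_smul, Uq.lift_gen]
  · change (unitK b : SLoc b) * r⁻¹ • (toLoc b (E b) * ↑(unitK b)⁻¹) =
      q b • r⁻¹ • (toLoc b (E b) * ↑(unitK b)⁻¹) * (unitK b : SLoc b)
    rw [mul_smul_comm, ← mul_assoc, h.KE, smul_comm (q b), smul_mul_assoc, smul_mul_assoc,
      smul_mul_assoc, mul_assoc, mul_assoc, cK.eq]
  · change (unitK b : SLoc b) * r⁻¹ • (toLoc b (F b) * ↑(unitK' b)⁻¹) =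
      (q b)⁻¹ • r⁻¹ • (toLoc b (F b) * ↑(unitK' b)⁻¹) * (unitK b : SLoc b)
    rw [mul_smul_comm, ← mul_assoc, h.KF, smul_comm (q b)⁻¹, smul_mul_assoc, smul_mul_assoc,
      smul_mul_assoc, mul_assoc, mul_assoc, cK'.eq]
  · exact (Commute.refl _).semiconjBy.mul_right cK'
  · exact (show SemiconjBy _ _ _ from h.KK').mul_right cK

/-- A homogeneous element of degree `n` is, up to the factor `Kⁿ`, in the image of `U_q(sl₂)`. -/
theorem exists_uqToSLoc_mul_pow {n : ℕ} {s : S b} (hs : s ∈ component b n) :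
    ∃ u, toLoc b s = uqToSLoc hb0 hb1 hb2 hr u * toLoc b (K b) ^ n := by
  have hr0 := ne_zero_of_sq_eq_q hb1 hb2 hr
  -- `T n` consists of the `s` whose image lies in the image of `U_q(sl₂)` times `Kⁿ`. Being a
  -- submodule, it can be tested on spanning sets.
  let T (n : ℕ) : Submodule ℂ (S b) := (LinearMap.range
    ((LinearMap.mulRight ℂ (toLoc b (K b) ^ n)).comp (uqToSLoc hb0 hb1 hb2 hr).toLinearMap)).comap
      (toLocAlg b).toLinearMap
  have mem_T {n : ℕ} {s : S b} (u : Uq (q b))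
      (h : toLoc b s = uqToSLoc hb0 hb1 hb2 hr u * toLoc b (K b) ^ n) : s ∈ T n := ⟨u, h.symm⟩
  have of_mem_T {n : ℕ} {s : S b} (h : s ∈ T n) :
      ∃ u, toLoc b s = uqToSLoc hb0 hb1 hb2 hr u * toLoc b (K b) ^ n := h.imp fun _ h => h.symm
  have hE : E b ∈ T 1 := mem_T (r • Uq.gen (q b) .e) (by
    rw [map_smul, uqToSLoc, Uq.lift_gen]
    change _ = r • r⁻¹ • (toLoc b (E b) * ↑(unitK b)⁻¹) * (unitK b : SLoc b) ^ 1
    rw [smul_inv_smul₀ hr0, pow_one, Units.inv_mul_cancel_right])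
  have hK' : K' b ∈ T 1 := mem_T (Uq.gen (q b) .kinv) (by
    rw [uqToSLoc, Uq.lift_gen]
    change _ = toLoc b (K' b) * ↑(unitK b)⁻¹ * (unitK b : SLoc b) ^ 1
    rw [pow_one, Units.inv_mul_cancel_right])
  have hK : K b ∈ T 1 := mem_T 1 (by rw [map_one, one_mul, pow_one])
  -- The factor `k⁻¹` turns the denominator `K'` of `f` into `K`: `F = FK'⁻¹ · K'K⁻¹ · K`.
  have hF : F b ∈ T 1 := mem_T (r • (Uq.gen (q b) .f * Uq.gen (q b) .kinv)) (by
    rw [map_smul, map_mul, uqToSLoc, Uq.lift_gen, Uq.lift_gen]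
    change _ = r • (r⁻¹ • (toLoc b (F b) * ↑(unitK' b)⁻¹) *
      ((unitK' b : SLoc b) * ↑(unitK b)⁻¹)) * (unitK b : SLoc b) ^ 1
    rw [smul_mul_assoc r⁻¹, smul_inv_smul₀ hr0, pow_one, ← mul_assoc, Units.inv_mul_cancel_right,
      Units.inv_mul_cancel_right])
  have hx : Submodule.span ℂ (Set.range (x b)) ≤ T 1 := by
    rw [Submodule.span_le]
    rintro _ ⟨i, rfl⟩
    rw [← xOfEFK_self hb0 hb1 hb2]
    fin_cases i
    · exact (T 1).smul_mem _ (add_mem hK hK')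
    · exact (T 1).smul_mem _ (sub_mem hK hK')
    · exact (T 1).smul_mem _ (add_mem ((T 1).smul_mem _ hE) ((T 1).smul_mem _ hF))
    · exact (T 1).smul_mem _ (sub_mem ((T 1).smul_mem _ hE) ((T 1).smul_mem _ hF))
  have hmul : ∀ n, component b n ≤ T n := by
    intro n
    induction n with
    | zero =>
      rw [component, pow_zero, Submodule.one_le]
      exact mem_T 1 (by rw [map_one, map_one, one_mul, pow_zero])
    | succ n ih =>
      rw [component, pow_succ' (Submodule.span ℂ (Set.range (x b)))]
      refine Submodule.mul_le.mpr fun y hy s hs => ?_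
      obtain ⟨u, hu⟩ := of_mem_T (hx hy)
      obtain ⟨v, hv⟩ := of_mem_T (ih hs)
      -- With `σ` the rescaling by `q`, `uK · vKⁿ = u σ(v) Kⁿ⁺¹`.
      refine mem_T (u * Uq.rescale (q b) (q_ne_zero hb1 hb2) v) ?_
      rw [map_mul, hu, hv, map_mul, pow_one, mul_assoc, ← mul_assoc (toLoc b (K b)),
        (uqToSLoc_semiconjBy hb0 hb1 hb2 hr v).eq, pow_succ' (toLoc b (K b))]
      simp only [mul_assoc]
  exact of_mem_T (hmul n hs)

theorem uqToSLoc_surjective {z : SLoc b} (hz : z ∈ SLocZero b) :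
    ∃ u, uqToSLoc hb0 hb1 hb2 hr u = z := by
  obtain ⟨n, s, hs, rfl⟩ := hz
  obtain ⟨u, hu⟩ := exists_uqToSLoc_mul_pow hb0 hb1 hb2 hr hs
  have hk : uqToSLoc hb0 hb1 hb2 hr (Uq.gen (q b) .k) * toLoc b (K b * K' b) =
      toLoc b (K b) ^ 2 := by
    rw [K_comm_K', map_mul, uqToSLoc, Uq.lift_gen]
    change toLoc b (K b) * ↑(unitK' b)⁻¹ * ((unitK' b : SLoc b) * toLoc b (K b)) = _
    rw [← mul_assoc, Units.inv_mul_cancel_right, pow_two (toLoc b (K b))]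
  -- `KK'` commutes with all fractions, not only with the image of `S`.
  have hc (y : SLoc b) : Commute y (toLoc b (K b * K' b)) := by
    induction y using OreLocalization.ind with | _ s t
    change s /ₒ t * ((K b * K' b) /ₒ 1) = (K b * K' b) /ₒ 1 * (s /ₒ t)
    rw [mul_div_one, oreDiv_mul_char (K b * K' b) s 1 t (K b * K' b) t (powersKK'_central b _ _),
      mul_one, (KK'_central b s).eq]
  have hpow : uqToSLoc hb0 hb1 hb2 hr (Uq.gen (q b) .k) ^ n * toLoc b ((K b * K' b) ^ n) =
      toLoc b (K b) ^ (2 * n) := by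
    rw [map_pow, ← (hc _).mul_pow, hk, pow_mul]
  have hs' : toLoc b ((K b * K' b) ^ n) * (s /ₒ powKK' b n) = toLoc b s :=
    OreLocalization.mul_cancel (s := powKK' b n)
  have hunit : IsUnit (toLoc b ((K b * K' b) ^ n)) := by
    rw [map_pow, map_mul]
    exact (((unitK b).isUnit).mul (unitK' b).isUnit).pow n
  -- The numerator has degree `2n`, so it equals `uK²ⁿ = u kⁿ(KK')ⁿ`; dividing by the unit `(KK')ⁿ`
  -- leaves `u kⁿ`.
  refine ⟨u * Uq.gen (q b) .k ^ n, hunit.mul_left_cancel ?_⟩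
  rw [hs', hu, map_mul, map_pow, ← hpow, ← mul_assoc (uqToSLoc hb0 hb1 hb2 hr u), map_pow,
    map_pow]
  exact ((hc _).pow_right n).eq.symm

/-- The isomorphism `U_q(sl₂) ≃ S[(KK')⁻¹]₀`. -/
noncomputable def uqEquiv : Uq (q b) ≃ₐ[ℂ] SLocZero b :=
  AlgEquiv.ofBijective ((uqToSLoc hb0 hb1 hb2 hr).codRestrict _ (uqToSLoc_mem hb0 hb1 hb2 hr))
    ⟨fun _ _ h => uqToSLoc_injective hb0 hb1 hb2 hr (congrArg Subtype.val h), fun z =>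
      (uqToSLoc_surjective hb0 hb1 hb2 hr z.2).imp fun _ h => Subtype.ext h⟩

theorem coe_uqEquiv (u : Uq (q b)) :
    (uqEquiv hb0 hb1 hb2 hr u : SLoc b) = uqToSLoc hb0 hb1 hb2 hr u := rfl

end iso

end DegenerateSklyanin

open DegenerateSklyanin in
theorem mainTheorem7 (b : ℂ) (hb0 : b ≠ 0) (hb1 : b ≠ Complex.I) (hb2 : b ≠ -Complex.I)
    (r : ℂ) (hr : r ^ 2 = q b) :
    (∃ ψ : EFKAlgebra (q b) ≃ₐ[ℂ] S b,
      ψ (EFKAlgebra.gen (q b) .E) = E b ∧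
      ψ (EFKAlgebra.gen (q b) .F) = F b ∧
      ψ (EFKAlgebra.gen (q b) .K) = K b ∧
      ψ (EFKAlgebra.gen (q b) .K') = K' b) ∧
    (∃ (hE : toLoc b (E b) * ((unitK b)⁻¹ : (SLoc b)ˣ) ∈ SLocZero b)
       (hF : toLoc b (F b) * ((unitK' b)⁻¹ : (SLoc b)ˣ) ∈ SLocZero b)
       (hK : toLoc b (K b) * ((unitK' b)⁻¹ : (SLoc b)ˣ) ∈ SLocZero b)
       (φ : SLocZero b ≃ₐ[ℂ] Uq (q b)),
      φ ⟨_, hE⟩ = r • Uq.gen (q b) .e ∧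
      φ ⟨_, hF⟩ = r • Uq.gen (q b) .f ∧
      φ ⟨_, hK⟩ = Uq.gen (q b) .k) := by
  have hr0 := ne_zero_of_sq_eq_q hb1 hb2 hr
  refine ⟨⟨efkEquiv hb0 hb1 hb2, EFKAlgebra.lift_gen .., EFKAlgebra.lift_gen ..,
    EFKAlgebra.lift_gen .., EFKAlgebra.lift_gen ..⟩,
    mul_invKK'_mem b (E_mem b) (K'_mem b), mul_invKK'_mem b (F_mem b) (K_mem b),
    mul_invKK'_mem b (K_mem b) (K_mem b), (uqEquiv hb0 hb1 hb2 hr).symm, ?_, ?_, ?_⟩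
  · rw [AlgEquiv.symm_apply_eq]
    apply Subtype.ext
    rw [coe_uqEquiv, map_smul, uqToSLoc, Uq.lift_gen]
    exact (smul_inv_smul₀ hr0 _).symm
  · rw [AlgEquiv.symm_apply_eq]
    apply Subtype.ext
    rw [coe_uqEquiv, map_smul, uqToSLoc, Uq.lift_gen]
    exact (smul_inv_smul₀ hr0 _).symm
  · rw [AlgEquiv.symm_apply_eq]
    apply Subtype.ext
    rw [coe_uqEquiv, uqToSLoc, Uq.lift_gen]
    rfl
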